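/- Let $d\ge 1$, and let $C_d=[0,1]^d$ be the $d$-cube. Then $C_d$ is realizable on an orthogonal surface in $\mathbb{R}^d$. That is, there are a facet $F$ of $C_d$ and a finite antichain $V\subset\mathbb{R}^d$ in the dominance order (the componentwise order $\le$) such that the cp-order of the orthogonal surface $S_V$ is a lattice and is isomorphic to the face lattice of $C_d$ (all faces, including $\emptyset$ and $C_d$, ordered by inclusion) with the element $F$ removed. Here $S_V$ is the topological boundary of the filter $\langle V\rangle=\{x\in\mathbb{R}^d : v\le x \text{ for some } v\in V\}$. For $v\in V$ and $i\in\{1,\dots,d\}$ let $U_i(v)$ be the set of all $p\in S_V$ with $p_i=v_i$ and $p_j>v_j$ for all $j\ne i$. Let $\sim_i^c$ be the transitive closure of the relation on $V$ given by $v\sim_i w \Leftrightarrow U_i(v)\cap U_i(w)\neq\emptyset$. The $i$-flat of $v$ is $F_i(v)=\overline{\bigcup_{w\sim_i^c v}U_i(w)}$. A characteristic point of $S_V$ is a point of $S_V$ that lies, for every $i\in\{1,\dots,d\}$, on some $i$-flat. The cp-order of $S_V$ is the set of characteristic points with the dominance order, together with an artificial least element $0$ and an artificial greatest element $1$. -/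

import Mathlib

namespace OrthogonalSurface

variable {d : ℕ}

/-- The filter `⟨V⟩` generated by `V` in the dominance order (the componentwise order on `ℝ^d`):
the union of the cones `{x | v ≤ x}` with `v ∈ V`. -/
def filterGen (V : Set (Fin d → ℝ)) : Set (Fin d → ℝ) :=
  {x | ∃ v ∈ V, v ≤ x}

/-- The orthogonal surface `S_V`: the topological boundary of the filter generated by `V`. -/
def surface (V : Set (Fin d → ℝ)) : Set (Fin d → ℝ) :=
  frontier (filterGen V)

/-- `p` almost strictly dominates `v` in direction `i`: they agree in coordinate `i`, and `p` is
strictly larger in every other coordinate. -/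
def AlmostStrictlyDominates (i : Fin d) (p v : Fin d → ℝ) : Prop :=
  p i = v i ∧ ∀ j, j ≠ i → v j < p j

/-- The almost strict upset `U_i(v)` on the surface `S_V`. -/
def almostStrictUpset (V : Set (Fin d → ℝ)) (i : Fin d) (v : Fin d → ℝ) : Set (Fin d → ℝ) :=
  {p | p ∈ surface V ∧ AlmostStrictlyDominates i p v}

/-- The relation `v ∼_i w` on `V`: the almost strict upsets `U_i(v)` and `U_i(w)` meet. -/
def UpsetsMeet (V : Set (Fin d → ℝ)) (i : Fin d) (v w : Fin d → ℝ) : Prop :=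
  v ∈ V ∧ w ∈ V ∧ (almostStrictUpset V i v ∩ almostStrictUpset V i w).Nonempty

/-- The `i`-flat `F_i(v)`: the closure of the union of the `U_i(w)` over all `w` that are related to
`v` by the transitive closure of `∼_i`. -/
def flat (V : Set (Fin d → ℝ)) (i : Fin d) (v : Fin d → ℝ) : Set (Fin d → ℝ) :=
  closure (⋃ w ∈ {w | Relation.TransGen (UpsetsMeet V i) v w}, almostStrictUpset V i w)

/-- A characteristic point of `S_V`: a point of the surface that lies on flats of all colors. -/
def IsCharacteristicPoint (V : Set (Fin d → ℝ)) (p : Fin d → ℝ) : Prop :=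
  p ∈ surface V ∧ ∀ i : Fin d, ∃ v ∈ V, p ∈ flat V i v

/-- The cp-order of `S_V`: the characteristic points with the dominance order, together with an
artificial least and an artificial greatest element. -/
abbrev CPOrder (V : Set (Fin d → ℝ)) : Type :=
  WithBot (WithTop {p : Fin d → ℝ // IsCharacteristicPoint V p})

/-- A partial order is a lattice: any two elements have a least upper bound and a greatest lower
bound. -/
def IsLatticeOrder (α : Type*) [PartialOrder α] : Prop :=
  ∀ a b : α, (∃ c, IsLUB {a, b} c) ∧ ∃ c, IsGLB {a, b} c

/-- The faces of a convex polytope `P`: the empty set, `P` itself, and the sets of points of `P`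
that maximize a linear functional over `P`. (`IsExposed ℝ P ∅` holds by convention, and `P` itself
is obtained from the zero functional.) -/
def IsFace (P F : Set (Fin d → ℝ)) : Prop :=
  IsExposed ℝ P F

/-- The facets of a convex polytope `P`: the nonempty faces of dimension `dim P - 1`, where the
dimension of a set is that of its affine span. -/
def IsFacet (P F : Set (Fin d → ℝ)) : Prop :=
  IsFace P F ∧ F.Nonempty ∧
    Module.finrank ℝ (vectorSpan ℝ F) + 1 = Module.finrank ℝ (vectorSpan ℝ P)

/-- The face lattice of `P` (all faces, including the empty face and `P`, ordered by inclusion) with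
the one element `F` removed. -/
abbrev FaceLatticeWithout (P F : Set (Fin d → ℝ)) : Type :=
  {G : Set (Fin d → ℝ) // IsFace P G ∧ G ≠ F}

/-- A `d`-polytope `P` is realizable on an orthogonal surface in `ℝ^d`: for some facet `F` of `P`
and some orthogonal surface `S_V` generated by a finite antichain `V` in `ℝ^d`, the cp-order of
`S_V` is a lattice, and it is isomorphic to the face lattice of `P` with `F` removed. -/
def IsRealizable (P : Set (Fin d → ℝ)) : Prop :=
  ∃ F : Set (Fin d → ℝ), IsFacet P F ∧
    ∃ V : Set (Fin d → ℝ), V.Finite ∧ IsAntichain (· ≤ ·) V ∧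
      IsLatticeOrder (CPOrder V) ∧ Nonempty (FaceLatticeWithout P F ≃o CPOrder V)

/-- The `d`-cube `[0,1]^d`. -/
def cube (d : ℕ) : Set (Fin d → ℝ) :=
  Set.Icc 0 1

end OrthogonalSurface

/-! For `d = n + 1 ≥ 2` each vertex `x` of the cube gets the generator `-vcost x`. A characteristic
point `p` is matched with the set of vertices whose generators lie below `p`, that is, whose costs
are at least the thresholds `q = -p`. The removed facet is the one where the last coordinate is 1.

Topology is eliminated by `isCharacteristicPoint_iff`. Call a coordinate tight for a generator `w ≤
p` if `w` and `p` agree there. Then `p` is characteristic iff each coordinate `i` is tight for some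
generator below `p` whose tight set contains no tight set, of a generator below `p`, that misses
`i`.

Costs grow strictly with the level. A one at `j` makes every later level at least `j + 1`, and a
zero at `j` gives the largest possible level at `j`, so lower bounds on levels can express both
kinds of facet condition. The last coordinate counts as a one for levels and only breaks ties: there
1 costs more than 0, except at level 0, where it costs less.

Coordinatewise minima of the costs over a nonempty face not containing the removed facet cut out
exactly that face (`exists_vcost_lt`) and are critical (`tight_of_tight_subset`). Conversely,
critical thresholds cut out the vertex set of such a face, by the exchange argument in
`exists_next_of_minimal`. The empty face and the whole cube become the artificial elements 0 and 1.
-/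

namespace OrthogonalSurface

open Set Filter Topology

/-! ### Combinatorial description of characteristic points. -/

section Characteristic

variable {d : ℕ}

theorem exists_lt_of_mem_interior_filterGen [Nonempty (Fin d)] {V : Set (Fin d → ℝ)}
    {x : Fin d → ℝ} (hx : x ∈ interior (filterGen V)) : ∃ v ∈ V, ∀ j, v j < x j := by
  have hlim : Tendsto (fun ε : ℝ => fun j => x j - ε) (𝓝[>] 0) (𝓝 x) := by
    have : Tendsto (fun ε : ℝ => fun j => x j - ε) (𝓝 0) (𝓝 (fun j => x j - 0)) :=
      Continuous.tendsto (by fun_prop) 0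
    simpa using this.mono_left nhdsWithin_le_nhds
  have hev := hlim.eventually (mem_interior_iff_mem_nhds.1 hx)
  obtain ⟨ε, ⟨v, hv, hle⟩, hε⟩ := (hev.and self_mem_nhdsWithin).exists
  refine ⟨v, hv, fun j => ?_⟩
  have h1 := hle j
  have h2 : (0 : ℝ) < ε := hε
  dsimp at h1
  linarith

theorem mem_interior_filterGen_of_lt {V : Set (Fin d → ℝ)} {v x : Fin d → ℝ} (hv : v ∈ V)
    (hx : ∀ j, v j < x j) : x ∈ interior (filterGen V) := by
  rw [mem_interior_iff_mem_nhds]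
  have : ∀ᶠ y in 𝓝 x, ∀ j, v j < y j :=
    eventually_all.2 fun j =>
      (continuous_apply j).continuousAt.eventually (lt_mem_nhds (hx j))
  filter_upwards [this] with y hy
  exact ⟨v, hv, fun j => (hy j).le⟩

/-- If `w` is tight for `p` in coordinate `i` and no element of `V` below `p` with smaller tight
set fails to be tight in coordinate `i`, then `p` is a limit of points of `U_i(w)`. -/
theorem mem_closure_almostStrictUpset [Nonempty (Fin d)] {V : Set (Fin d → ℝ)} (hV : V.Finite)
    {p w : Fin d → ℝ} {i : Fin d} (hw : w ∈ V) (hwp : w ≤ p) (hi : w i = p i)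
    (hmin : ∀ v ∈ V, v ≤ p → (∀ j, v j = p j → w j = p j) → v i = p i) :
    p ∈ closure (almostStrictUpset V i w) := by
  classical
  -- Raising `p` off `i` where `w` is tight puts the point in direction `i` above `w`. For small
  -- `ε`, a generator strictly below it would be below `p`, with tight set inside that of `w` and
  -- missing `i`, contrary to `hmin`.
  let f : ℝ → Fin d → ℝ := fun ε j => if w j = p j ∧ j ≠ i then p j + ε else p j
  have hlim : Tendsto f (𝓝[>] 0) (𝓝 p) := by
    rw [tendsto_pi_nhds]
    intro j
    by_cases h : w j = p j ∧ j ≠ i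
    · simp only [f, h, and_self, if_true, ne_eq, not_false_eq_true]
      have : Tendsto (fun ε : ℝ => p j + ε) (𝓝 0) (𝓝 (p j + 0)) :=
        Continuous.tendsto (by fun_prop) 0
      simpa using this.mono_left nhdsWithin_le_nhds
    · simp only [f, h, if_false]
      exact tendsto_const_nhds
  have hsmall : ∀ᶠ ε : ℝ in 𝓝[>] 0, ∀ v ∈ V, ∀ j, v j < p j + ε → v j ≤ p j := by
    rw [eventually_all_finite hV]
    intro v _
    rw [eventually_all]
    intro j
    by_cases h : v j ≤ p j
    · exact Eventually.of_forall fun _ _ => h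
    · push Not at h
      have : ∀ᶠ ε : ℝ in 𝓝 0, ε < v j - p j := gt_mem_nhds (by linarith)
      filter_upwards [nhdsWithin_le_nhds this] with ε h1 h2
      linarith
  refine mem_closure_of_tendsto hlim ?_
  filter_upwards [hsmall, self_mem_nhdsWithin] with ε hε hpos
  have hpos : (0 : ℝ) < ε := hpos
  have hle : ∀ j, p j ≤ f ε j := by
    intro j; simp only [f]; split_ifs <;> linarith
  refine ⟨⟨subset_closure ⟨w, hw, fun j => (hwp j).trans (hle j)⟩, fun hint => ?_⟩, ?_, ?_⟩
  · obtain ⟨v, hv, hlt⟩ := exists_lt_of_mem_interior_filterGen hint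
    have hvp : v ≤ p := by
      intro j
      refine hε v hv j ((hlt j).trans_le ?_)
      simp only [f]; split_ifs <;> linarith
    have htight : ∀ j, v j = p j → w j = p j ∧ j ≠ i := by
      intro j hj
      by_contra h
      have := hlt j
      simp only [f, h, if_false] at this
      linarith
    exact (htight i (hmin v hv hvp fun j hj => (htight j hj).1)).2 rfl
  · simp [f, hi]
  · intro j hj
    by_cases h : w j = p j
    · simp only [f, h, hj, ne_eq, not_false_eq_true, and_self, if_true]; linarith
    · simp only [f, h, false_and, if_false]
      exact lt_of_le_of_ne (hwp j) h

/-- A generator `v` violating the last clause would be strictly below all points of `U_i(w)` near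
`p`: off its tight set by continuity, on it because those points exceed `w` off `i`. Such points are
interior to the filter, hence not on the surface. -/
theorem tight_of_mem_closure_almostStrictUpset {V : Set (Fin d → ℝ)}
    {p w : Fin d → ℝ} {i : Fin d} (hp : p ∈ closure (almostStrictUpset V i w)) :
    w ≤ p ∧ w i = p i ∧
      ∀ v ∈ V, v ≤ p → (∀ j, v j = p j → w j = p j) → v i = p i := by
  have hclosed : IsClosed {x : Fin d → ℝ | w ≤ x ∧ w i = x i} :=
    isClosed_Ici.inter (isClosed_eq continuous_const (continuous_apply i))
  have hsub : almostStrictUpset V i w ⊆ {x : Fin d → ℝ | w ≤ x ∧ w i = x i} := by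
    rintro x ⟨-, hx, hlt⟩
    refine ⟨fun j => ?_, hx.symm⟩
    by_cases h : j = i
    · rw [h, hx]
    · exact (hlt j h).le
  obtain ⟨hwp, hi⟩ := closure_minimal hsub hclosed hp
  refine ⟨hwp, hi, fun v hv hvp htight => ?_⟩
  by_contra hne
  have hnear : ∀ᶠ y in 𝓝 p, ∀ j, v j < p j → v j < y j :=
    eventually_all.2 fun j => by
      by_cases h : v j < p j
      · filter_upwards [(continuous_apply j).continuousAt.eventually (lt_mem_nhds h)] with y hy _
        exact hy
      · exact Eventually.of_forall fun _ h' => absurd h' h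
  obtain ⟨y, hy, ⟨-, hyint⟩, -, hylt⟩ := mem_closure_iff_nhds.1 hp _ hnear
  refine hyint (mem_interior_filterGen_of_lt hv fun j => ?_)
  rcases (hvp j).lt_or_eq with h | h
  · exact hy j h
  · rw [h, ← htight j h]
    exact hylt j fun hji => hne (hji ▸ h)

/-- Characteristic points in terms of tight coordinates: every coordinate is tight for an element
of `V` below `p` whose tight set is, as far as that coordinate is concerned, minimal. -/
theorem isCharacteristicPoint_iff [Nonempty (Fin d)] {V : Set (Fin d → ℝ)} (hV : V.Finite)
    (p : Fin d → ℝ) :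
    IsCharacteristicPoint V p ↔ ∀ i, ∃ w ∈ V, w ≤ p ∧ w i = p i ∧
      ∀ v ∈ V, v ≤ p → (∀ j, v j = p j → w j = p j) → v i = p i := by
  constructor
  · rintro ⟨-, h⟩ i
    obtain ⟨v, -, hp⟩ := h i
    have hsub : {w | Relation.TransGen (UpsetsMeet V i) v w} ⊆ V := by
      intro w hw
      obtain ⟨_, _, h⟩ := Relation.TransGen.tail'_iff.1 hw
      exact h.2.1
    rw [flat, (hV.subset hsub).closure_biUnion] at hp
    obtain ⟨w, hw, hp⟩ := mem_iUnion₂.1 hp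
    exact ⟨w, hsub hw, tight_of_mem_closure_almostStrictUpset hp⟩
  · intro h
    have hcl : ∀ i, ∃ w ∈ V, p ∈ closure (almostStrictUpset V i w) := fun i =>
      let ⟨w, hw, hwp, hi, hmin⟩ := h i
      ⟨w, hw, mem_closure_almostStrictUpset hV hw hwp hi hmin⟩
    refine ⟨?_, fun i => ?_⟩
    · obtain ⟨w, -, hp⟩ := hcl (Classical.arbitrary _)
      exact closure_minimal (fun x hx => hx.1) isClosed_frontier hp
    · obtain ⟨w, hw, hp⟩ := hcl i
      have hne : (almostStrictUpset V i w).Nonempty := closure_nonempty_iff.1 ⟨p, hp⟩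
      refine ⟨w, hw, closure_mono ?_ hp⟩
      exact subset_biUnion_of_mem (u := fun w => almostStrictUpset V i w)
        (Relation.TransGen.single ⟨hw, hw, by rwa [inter_self]⟩)

end Characteristic

/-! ### Levels and costs of the vertices of the cube. -/

section Levels

variable {n : ℕ}

/-- The coordinate `i` of the vertex `x` is one, where the last coordinate counts as one. -/
def IsOne (x : Fin (n + 1) → Bool) (i : Fin (n + 1)) : Prop :=
  i = Fin.last n ∨ x i = true

open Classical in
/-- The level of `i` in `x`: if the coordinate `i` is one, it is `j + 1` for the previous one `j`
and `0` if there is none; otherwise it is `i + 1`. -/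
noncomputable def level (x : Fin (n + 1) → Bool) (i : Fin (n + 1)) : ℕ :=
  if IsOne x i then (Finset.univ.filter fun j => j < i ∧ x j = true).sup (fun j => j.val + 1)
  else i.val + 1

theorem level_of_not_isOne {x : Fin (n + 1) → Bool} {i : Fin (n + 1)} (h : ¬ IsOne x i) :
    level x i = i.val + 1 := by
  simp [level, h]

theorem level_le_of_isOne {x : Fin (n + 1) → Bool} {i : Fin (n + 1)} (h : IsOne x i) {m : ℕ}
    (hm : ∀ j < i, x j = true → j.val + 1 ≤ m) : level x i ≤ m := by
  simp only [level, h, if_true]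
  refine Finset.sup_le fun j hj => ?_
  simp only [Finset.mem_filter, Finset.mem_univ, true_and] at hj
  exact hm j hj.1 hj.2

theorem level_le_val {x : Fin (n + 1) → Bool} {i : Fin (n + 1)} (h : IsOne x i) :
    level x i ≤ i.val :=
  level_le_of_isOne h fun _ hj _ => hj

theorem level_le_succ (x : Fin (n + 1) → Bool) (i : Fin (n + 1)) : level x i ≤ i.val + 1 := by
  by_cases h : IsOne x i
  · exact (level_le_val h).trans (Nat.le_succ _)
  · exact (level_of_not_isOne h).le

theorem isOne_of_level_le {x : Fin (n + 1) → Bool} {i : Fin (n + 1)} (h : level x i ≤ i.val) :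
    IsOne x i := by
  by_contra h'
  rw [level_of_not_isOne h'] at h
  omega

theorem succ_le_level {x : Fin (n + 1) → Bool} {i j : Fin (n + 1)} (hj : j < i)
    (hx : x j = true) : j.val + 1 ≤ level x i := by
  by_cases h : IsOne x i
  · simp only [level, h, if_true]
    exact Finset.le_sup (f := fun j : Fin (n + 1) => j.val + 1) (by simp [hj, hx])
  · rw [level_of_not_isOne h]
    have : j.val < i.val := hj
    omega

theorem exists_of_level_pos {x : Fin (n + 1) → Bool} {i : Fin (n + 1)} (h : IsOne x i)
    (hpos : 0 < level x i) : ∃ j < i, x j = true ∧ j.val + 1 = level x i := by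
  by_contra! hno
  have : level x i ≤ level x i - 1 := level_le_of_isOne h fun j hj hx => by
    have h1 := succ_le_level hj hx
    have h2 := hno j hj hx
    omega
  omega

/-- The first one at or after a given position. -/
theorem exists_next (x : Fin (n + 1) → Bool) {m : ℕ} (hm : m ≤ n) :
    ∃ k : Fin (n + 1), m ≤ k.val ∧ IsOne x k ∧ (∀ j < k, m ≤ j.val → x j = false) ∧
      level x k ≤ m := by
  classical
  obtain ⟨k, ⟨h1, h2⟩, hmin⟩ := WellFounded.has_min (r := ((· < ·) : Fin (n + 1) → _ → Prop))
    wellFounded_lt {k | m ≤ k.val ∧ IsOne x k} ⟨Fin.last n, hm, Or.inl rfl⟩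
  have h3 : ∀ j < k, m ≤ j.val → x j = false := by
    intro j hj hmj
    by_contra h
    exact hmin j ⟨hmj, Or.inr (by simpa using h)⟩ hj
  refine ⟨k, h1, h2, h3, level_le_of_isOne h2 fun j hj hx => ?_⟩
  by_contra h
  have := h3 j hj (by omega)
  simp [this] at hx

/-- The costs, increasing in the level; the last coordinate decides ties. -/
noncomputable def cost (a : ℕ) (e : Bool) : ℝ :=
  if e = true then (if a = 0 then -1 else 2 * a + 1) else 2 * a

theorem cost_lt_cost {a b : ℕ} (h : a < b) (e e' : Bool) : cost a e < cost b e' := by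
  have h1 : (a : ℝ) + 1 ≤ b := by exact_mod_cast h
  have h2 : (0 : ℝ) ≤ a := Nat.cast_nonneg a
  have h3 : b ≠ 0 := by omega
  cases e <;> cases e' <;> simp only [cost, h3, if_true, if_false, Bool.false_eq_true] <;>
    (try split_ifs) <;> linarith

theorem le_of_cost_le {a b : ℕ} {e e' : Bool} (h : cost a e ≤ cost b e') : a ≤ b := by
  by_contra! h'
  exact absurd (cost_lt_cost h' e' e) (not_lt.2 h)

theorem cost_mono {a b : ℕ} (h : a ≤ b) (e : Bool) : cost a e ≤ cost b e := by
  rcases h.lt_or_eq with h | rfl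
  · exact (cost_lt_cost h e e).le
  · exact le_rfl

theorem cost_false_lt_cost_true {a b : ℕ} (h : a ≤ b) (hb : 0 < b) :
    cost a false < cost b true := by
  rcases h.lt_or_eq with h | rfl
  · exact cost_lt_cost h _ _
  · simp [cost, hb.ne']

theorem neg_one_le_cost (a : ℕ) (e : Bool) : -1 ≤ cost a e := by
  have h2 : (0 : ℝ) ≤ a := Nat.cast_nonneg a
  cases e <;> simp only [cost, if_true, if_false, Bool.false_eq_true] <;>
    (try split_ifs) <;> linarith

theorem cost_zero_true : cost 0 true = -1 := by simp [cost]

theorem cost_false_nonneg (a : ℕ) : 0 ≤ cost a false := by simp [cost]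

/-- The cost of the vertex `x` in coordinate `i`. -/
noncomputable def vcost (x : Fin (n + 1) → Bool) (i : Fin (n + 1)) : ℝ :=
  cost (level x i) (x (Fin.last n))

/-- A set of vertices of the cube is closed if it is the vertex set of a face. -/
def IsVertexClosed {d : ℕ} (A : Set (Fin d → Bool)) : Prop :=
  ∀ x, (∀ j, ∃ v ∈ A, v j = x j) → x ∈ A

/-- The vertices of the removed facet. -/
def topVertices (n : ℕ) : Set (Fin (n + 1) → Bool) :=
  {x | x (Fin.last n) = true}

theorem ne_last_of_lt {i j : Fin (n + 1)} (h : j < i) : j ≠ Fin.last n :=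
  (h.trans_le (Fin.le_last i)).ne

theorem eq_true_of_isOne {x : Fin (n + 1) → Bool} {i j : Fin (n + 1)} (h : IsOne x j)
    (hj : j < i) : x j = true :=
  h.resolve_left (ne_last_of_lt hj)

/-- The vertex that agrees with `w` before `m` and after `u`, and has its only one between
at `u`. -/
theorem exists_splice (w : Fin (n + 1) → Bool) {m : ℕ} {u : Fin (n + 1)} (hmu : m ≤ u.val)
    (hm : ∀ j : Fin (n + 1), j.val + 1 = m → w j = true) :
    ∃ x : Fin (n + 1) → Bool, x (Fin.last n) = w (Fin.last n) ∧ level x u = m ∧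
      (∀ k, k ≠ u → level w k ≤ level x k) ∧
      ∀ k, m ≤ k.val → k ≠ u → m < level x k := by
  classical
  let x : Fin (n + 1) → Bool := fun j =>
    if j.val < m ∨ u < j ∨ j = Fin.last n then w j else decide (j = u)
  have hx1 : ∀ j : Fin (n + 1), j.val < m → x j = w j := fun j hj => by simp [x, hj]
  have hx2 : ∀ j : Fin (n + 1), u < j → x j = w j := fun j hj => by simp [x, hj]
  have hlast : x (Fin.last n) = w (Fin.last n) := by simp [x]
  have hx3 : ∀ j : Fin (n + 1), m ≤ j.val → j < u → ¬ IsOne x j := by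
    intro j h1 h2 h
    have := eq_true_of_isOne h h2
    simp [x, not_lt.2 h1, not_lt.2 h2.le, ne_last_of_lt h2, h2.ne] at this
  have hxu : IsOne x u := by
    by_cases h : u = Fin.last n
    · exact Or.inl h
    · exact Or.inr (by simp [x, not_lt.2 hmu, h])
  have hiff : ∀ j : Fin (n + 1), j.val < m ∨ u < j → (IsOne x j ↔ IsOne w j) := by
    rintro j (h | h)
    · simp [IsOne, hx1 j h]
    · simp [IsOne, hx2 j h]
  have hafter : ∀ k : Fin (n + 1), u < k → u.val + 1 ≤ level x k := fun k hk =>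
    succ_le_level hk (eq_true_of_isOne hxu hk)
  refine ⟨x, hlast, le_antisymm ?_ ?_, ?_, ?_⟩
  · refine level_le_of_isOne hxu fun j hj hxj => ?_
    by_contra h
    exact hx3 j (by omega) hj (Or.inr hxj)
  · rcases Nat.eq_zero_or_pos m with h | h
    · omega
    · have h1 : m - 1 < n + 1 := by have := u.isLt; omega
      have h2 : (⟨m - 1, h1⟩ : Fin (n + 1)) < u := by
        rw [Fin.lt_def]; simp only; omega
      have h3 : x ⟨m - 1, h1⟩ = true := by
        rw [hx1 _ (by simp only; omega)]
        exact hm _ (by simp only; omega)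
      have := succ_le_level h2 h3
      simp only at this
      omega
  -- Zeros between `m` and `u` have maximal level; beyond `u`, the one at `u` compensates for the
  -- ones of `w` that were erased.
  · intro k hk
    rcases lt_or_gt_of_ne hk with h | h
    · by_cases hkm : m ≤ k.val
      · rw [level_of_not_isOne (hx3 k hkm h)]
        exact level_le_succ w k
      · push Not at hkm
        by_cases hone : IsOne w k
        · refine level_le_of_isOne hone fun j hj hwj => succ_le_level hj ?_
          rw [hx1 j (lt_trans hj hkm), hwj]
        · rw [level_of_not_isOne (mt (hiff k (Or.inl hkm)).1 hone)]
          exact level_le_succ w k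
    · by_cases hone : IsOne w k
      · refine level_le_of_isOne hone fun j hj hwj => ?_
        by_cases huj : u < j
        · exact succ_le_level hj (by rw [hx2 j huj, hwj])
        · refine le_trans ?_ (hafter k h)
          have : j.val ≤ u.val := not_lt.1 huj
          omega
      · rw [level_of_not_isOne (mt (hiff k (Or.inr h)).1 hone)]
        exact level_le_succ w k
  · intro k hk hku
    rcases lt_or_gt_of_ne hku with h | h
    · rw [level_of_not_isOne (hx3 k hk h)]
      omega
    · have := hafter k h
      omega

/-! ### Critical thresholds cut out faces. -/

/-- The thresholds `q` have, in every coordinate `i`, a vertex that is tight at `i` and that has no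
vertex with a smaller tight set and not tight at `i`. -/
def IsCritical (q : Fin (n + 1) → ℝ) : Prop :=
  ∀ i, ∃ w, q ≤ vcost w ∧ vcost w i = q i ∧
    ∀ v, q ≤ vcost v → (∀ j, vcost v j = q j → vcost w j = q j) → vcost v i = q i

/-- Exchange argument: let `u` be the first one of `v` from `m = level w i` on. If `v` were too
cheap at `u`, splicing `w` at `u` would give a vertex not tight at `u`, nowhere else cheaper than
`w`, and of level above `m` at `i`. Its tight set lies in that of `w` and misses `i`, contradicting
minimality. For `m > 0` the conclusion forces `v` to have a one at `m - 1`. -/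
theorem exists_next_of_minimal {q : Fin (n + 1) → ℝ} {w v : Fin (n + 1) → Bool}
    {i : Fin (n + 1)} (hw : q ≤ vcost w) (hi : vcost w i = q i)
    (hmin : ∀ v, q ≤ vcost v → (∀ j, vcost v j = q j → vcost w j = q j) → vcost v i = q i)
    (hone : IsOne w i) (hv : q ≤ vcost v) :
    ∃ u, IsOne v u ∧ level w i ≤ u.val ∧ level v u = level w i ∧
      cost (level w i) (w (Fin.last n)) ≤ cost (level w i) (v (Fin.last n)) := by
  set m := level w i with hm
  have hmi : m ≤ i.val := level_le_val hone
  obtain ⟨u, hmu, hu, -, hle⟩ := exists_next v (hmi.trans (Nat.lt_succ_iff.1 i.isLt))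
  have key : cost m (w (Fin.last n)) ≤ cost (level v u) (v (Fin.last n)) := by
    by_cases hui : u = i
    · have h1 := hv i
      rw [← hi] at h1
      rw [hui]
      exact h1
    · by_contra! hlt
      obtain ⟨x, hlast, hxu, hge, hgt⟩ := exists_splice w hmu (fun j hj => by
        obtain ⟨j', -, h1, h2⟩ := exists_of_level_pos hone (by omega)
        have : j = j' := Fin.ext (by omega)
        rw [this, h1])
      have hqu : q u < vcost x u := by
        refine (hv u).trans_lt ?_
        simp only [vcost]
        rw [hxu, hlast]
        exact hlt
      have hwx : ∀ k, k ≠ u → vcost w k ≤ vcost x k := by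
        intro k hk
        simp only [vcost]
        rw [hlast]
        exact cost_mono (hge k hk) _
      have hqx : q ≤ vcost x := by
        intro k
        by_cases hk : k = u
        · rw [hk]; exact hqu.le
        · exact (hw k).trans (hwx k hk)
      have hxi := hmin x hqx (fun j hj => by
        by_cases hk : j = u
        · rw [hk] at hj; exact absurd hj hqu.ne'
        · exact le_antisymm ((hwx j hk).trans hj.le) (hw j))
      have : vcost w i < vcost x i := cost_lt_cost (hgt i hmi (Ne.symm hui)) _ _
      linarith
  have hmv : level v u = m := le_antisymm hle (le_of_cost_le key)
  exact ⟨u, hu, hmu, hmv, hmv ▸ key⟩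

theorem IsCritical.isVertexClosed {q : Fin (n + 1) → ℝ} (hq : IsCritical q) :
    IsVertexClosed {x : Fin (n + 1) → Bool | q ≤ vcost x} := by
  intro x hx i
  obtain ⟨w, hw, hi, hmin⟩ := hq i
  obtain ⟨v, hv, hvlast⟩ := hx (Fin.last n)
  rw [← hi]
  by_cases hone : IsOne w i
  · obtain ⟨u, -, hmu, -, hcost⟩ := exists_next_of_minimal hw hi hmin hone hv
    -- All vertices above the thresholds share the one at `level w i - 1`, hence so does `x`.
    have hle : level w i ≤ level x i := by
      rcases Nat.eq_zero_or_pos (level w i) with h | h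
      · omega
      · obtain ⟨j, hj, -, hjm⟩ := exists_of_level_pos hone h
        obtain ⟨v', hv', hvj⟩ := hx j
        obtain ⟨u', hu', hmu', hlev, -⟩ := exists_next_of_minimal hw hi hmin hone hv'
        obtain ⟨j', -, h1, h2⟩ := exists_of_level_pos hu' (by omega)
        have hjj : j' = j := Fin.ext (by omega)
        rw [hjj] at h1
        have := succ_le_level hj (hvj ▸ h1)
        omega
    rw [hvlast] at hcost
    exact hcost.trans (cost_mono hle _)
  · have hlev := level_of_not_isOne hone
    -- The level of `w` at `i` is already the largest possible, so every vertex above the thresholds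
    -- has a zero at `i`.
    have hle : ∀ v', q ≤ vcost v' → level v' i = i.val + 1 := by
      intro v' hv'
      have h1 := hv' i
      rw [← hi] at h1
      have h2 := le_of_cost_le h1
      have h3 := level_le_succ v' i
      omega
    have hxlev : level x i = i.val + 1 := by
      apply level_of_not_isOne
      rintro (h | h)
      · exact hone (Or.inl h)
      · obtain ⟨v', hv', hvi⟩ := hx i
        have h1 := level_le_val (x := v') (i := i) (Or.inr (hvi.trans h))
        have h2 := hle v' hv'
        omega
    have h1 := hv i
    rw [← hi] at h1
    simp only [vcost] at h1 ⊢
    rw [hle v hv] at h1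
    rw [hxlev, ← hvlast]
    exact h1

theorem IsCritical.nonempty {q : Fin (n + 1) → ℝ} (hq : IsCritical q) :
    {x : Fin (n + 1) → Bool | q ≤ vcost x}.Nonempty :=
  let ⟨w, hw, _⟩ := hq 0
  ⟨w, hw⟩

/-- Here the exceptional cost -1 matters: the facet would force all thresholds down to -1, and then
the zero vertex, whose costs are nonnegative, has empty tight set. -/
theorem IsCritical.not_topVertices_subset {q : Fin (n + 1) → ℝ} (hq : IsCritical q) :
    ¬ topVertices n ⊆ {x : Fin (n + 1) → Bool | q ≤ vcost x} := by
  classical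
  intro hsub
  have hq1 : ∀ i, q i ≤ -1 := by
    intro i
    let x : Fin (n + 1) → Bool := fun j => decide (j = i ∨ j = Fin.last n)
    have hx : q ≤ vcost x := hsub (by simp [topVertices, x])
    have hlev : level x i = 0 := by
      refine Nat.le_zero.1 (level_le_of_isOne (Or.inr (by simp [x])) fun j hj hxj => ?_)
      simp [x, hj.ne, ne_last_of_lt hj] at hxj
    have := hx i
    simp only [vcost] at this
    rw [hlev] at this
    simpa [x, cost_zero_true] using this
  have hzero : ∀ i, q i < vcost (fun _ : Fin (n + 1) => false) i := fun i => by
    have h1 := cost_false_nonneg (level (fun _ : Fin (n + 1) => false) i)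
    have h2 := hq1 i
    simp only [vcost]
    linarith
  obtain ⟨w, -, -, hmin⟩ := hq 0
  exact (hzero 0).ne' (hmin _ (fun i => (hzero i).le) fun j hj => absurd hj (hzero j).ne')

/-! ### Faces are cut out by critical thresholds. -/

/-- A closed set that misses a vertex of the removed facet has a constant coordinate other than
the last one, if it has a vertex on that facet. -/
theorem exists_constant_coordinate {A : Set (Fin (n + 1) → Bool)} (hA : IsVertexClosed A)
    (htop : ¬ topVertices n ⊆ A) {w : Fin (n + 1) → Bool} (hw : w ∈ A)
    (hlast : w (Fin.last n) = true) :
    ∃ j, j ≠ Fin.last n ∧ ∃ b, ∀ h ∈ A, h j = b := by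
  obtain ⟨x, hx, hxA⟩ := Set.not_subset.1 htop
  have : ∃ j, ∀ v ∈ A, v j ≠ x j := by
    by_contra! hno
    exact hxA (hA x hno)
  obtain ⟨j, hj⟩ := this
  refine ⟨j, fun h => hj w hw ?_, !(x j), fun h hh => ?_⟩
  · rw [h, hlast]; exact hx.symm
  · have := hj h hh
    revert this
    cases h j <;> cases x j <;> simp

/-- A vertex with smaller last coordinate can be separated through a constant coordinate. -/
theorem exists_cost_separation {A : Set (Fin (n + 1) → Bool)} {j : Fin (n + 1)}
    (hj : j ≠ Fin.last n) {b : Bool} (hA : ∀ h ∈ A, h j = b) {v : Fin (n + 1) → Bool}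
    (hvj : v j = b) (hv : v (Fin.last n) = false) :
    ∃ k, ∀ h ∈ A, vcost v k ≤ vcost h k ∧
      (h (Fin.last n) = true → vcost v k < vcost h k) := by
  have hjn : j.val + 1 ≤ n := by
    have h1 : j.val ≠ n := fun h => hj (Fin.ext h)
    have := j.isLt
    omega
  -- Positivity is needed because the tie-break is reversed at level 0.
  have hsuff : ∃ k, ∀ h ∈ A, level v k ≤ level h k ∧ 0 < level h k := by
    cases b with
    | false =>
      refine ⟨j, fun h hh => ?_⟩
      have : ∀ y : Fin (n + 1) → Bool, y j = false → level y j = j.val + 1 := fun y hy =>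
        level_of_not_isOne (by simp [IsOne, hj, hy])
      rw [this v hvj, this h (hA h hh)]
      omega
    | true =>
      obtain ⟨k, hk, -, -, hle⟩ := exists_next v hjn
      refine ⟨k, fun h hh => ?_⟩
      have := succ_le_level (x := h) (i := k) (j := j) hk (hA h hh)
      omega
  obtain ⟨k, hk⟩ := hsuff
  refine ⟨k, fun h hh => ?_⟩
  obtain ⟨h1, h2⟩ := hk h hh
  have hlt : h (Fin.last n) = true → vcost v k < vcost h k := fun hl => by
    simp only [vcost, hv, hl]
    exact cost_false_lt_cost_true h1 h2
  refine ⟨?_, hlt⟩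
  cases hl : h (Fin.last n) with
  | true => exact (hlt hl).le
  | false =>
    simp only [vcost, hv, hl]
    exact cost_mono h1 _

/-- Some coordinate of `v` differs from that of every vertex of `A`. If it is not the last, levels
alone separate: at that coordinate if `v` has a one there, at the next one of `v` otherwise. If it
is the last, the tie-break separates, through the cost -1 when `v` ends in 1. -/
theorem exists_vcost_lt {A : Set (Fin (n + 1) → Bool)} (hA : IsVertexClosed A)
    (hne : A.Nonempty) (htop : ¬ topVertices n ⊆ A) {v : Fin (n + 1) → Bool} (hv : v ∉ A) :
    ∃ i, ∀ h ∈ A, vcost v i < vcost h i := by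
  have hsep : ∀ j, j ≠ Fin.last n → (∀ h ∈ A, h j ≠ v j) →
      ∃ i, ∀ h ∈ A, vcost v i < vcost h i := by
    intro j hj hne
    cases hvj : v j with
    | true =>
      refine ⟨j, fun h hh => cost_lt_cost ?_ _ _⟩
      have h1 : h j = false := by simpa [hvj] using hne h hh
      rw [level_of_not_isOne (x := h) (by simp [IsOne, hj, h1])]
      have := level_le_val (x := v) (i := j) (Or.inr hvj)
      omega
    | false =>
      obtain ⟨k, hk, hone, -, hle⟩ := exists_next v (m := j.val) (by have := j.isLt; omega)
      have hjk : j < k := lt_of_le_of_ne hk (by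
        rintro rfl
        rcases hone with h | h
        · exact hj h
        · simp [hvj] at h)
      refine ⟨k, fun h hh => cost_lt_cost ?_ _ _⟩
      have h1 : h j = true := by simpa [hvj] using hne h hh
      have := succ_le_level hjk h1
      omega
  have : ∃ j, ∀ h ∈ A, h j ≠ v j := by
    by_contra! hno
    exact hv (hA v hno)
  obtain ⟨j, hj⟩ := this
  by_cases hjl : j = Fin.last n
  · subst hjl
    cases hvl : v (Fin.last n) with
    | true =>
      obtain ⟨k, -, -, -, hle⟩ := exists_next v (Nat.zero_le n)
      refine ⟨k, fun h hh => ?_⟩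
      have h1 : h (Fin.last n) = false := by simpa [hvl] using hj h hh
      simp only [vcost, h1, hvl, Nat.le_zero.1 hle, cost_zero_true]
      linarith [cost_false_nonneg (level h k)]
    | false =>
      have hall : ∀ h ∈ A, h (Fin.last n) = true := fun h hh => by simpa [hvl] using hj h hh
      obtain ⟨w, hw⟩ := hne
      obtain ⟨k, hk, b, hb⟩ := exists_constant_coordinate hA htop hw (hall w hw)
      by_cases hvb : v k = b
      · obtain ⟨i, hi⟩ := exists_cost_separation hk hb hvb hvl
        exact ⟨i, fun h hh => (hi h hh).2 (hall h hh)⟩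
      · exact hsep k hk fun h hh => by rw [hb h hh]; exact fun h' => hvb h'.symm
  · exact hsep j hjl hj

theorem IsVertexClosed.update_mem {d : ℕ} {A : Set (Fin d → Bool)} (hA : IsVertexClosed A)
    {w h : Fin d → Bool} (hw : w ∈ A) (hh : h ∈ A) (j : Fin d) :
    Function.update w j (h j) ∈ A := by
  refine hA _ fun k => ?_
  by_cases hk : k = j
  · subst hk; exact ⟨h, hh, by simp⟩
  · exact ⟨w, hw, by simp [hk]⟩

/-- The tight sets of the vertices of a face are an antichain. -/
theorem tight_of_tight_subset {A : Set (Fin (n + 1) → Bool)} (hA : IsVertexClosed A)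
    (htop : ¬ topVertices n ⊆ A) {q : Fin (n + 1) → ℝ} (hq : ∀ i, ∀ h ∈ A, q i ≤ vcost h i)
    (hatt : ∀ i, ∃ h ∈ A, vcost h i = q i) {w v : Fin (n + 1) → Bool} (hw : w ∈ A) (hv : v ∈ A)
    (hsub : ∀ j, vcost v j = q j → vcost w j = q j) {i : Fin (n + 1)} (hi : vcost w i = q i) :
    vcost v i = q i := by
  have hq' : ∀ k, (∀ h ∈ A, vcost v k ≤ vcost h k) → vcost v k = q k := fun k hk => by
    obtain ⟨h, hh, heq⟩ := hatt k
    exact le_antisymm (heq ▸ hk h hh) (hq k v hv)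
  -- If the last coordinates differed, `v` would be tight at some `k` where `w` is strictly more
  -- expensive.
  have hlast : v (Fin.last n) = w (Fin.last n) := by
    cases hvl : v (Fin.last n) <;> cases hwl : w (Fin.last n)
    · rfl
    · obtain ⟨j, hj, b, hb⟩ := exists_constant_coordinate hA htop hw hwl
      obtain ⟨k, hk⟩ := exists_cost_separation hj hb (hb v hv) hvl
      have h1 := hq' k fun h hh => (hk h hh).1
      have h2 := (hk w hw).2 hwl
      rw [hsub k h1, h1] at h2
      exact absurd h2 (lt_irrefl _)
    · obtain ⟨k, -, -, -, hle⟩ := exists_next v (Nat.zero_le n)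
      have h0 : vcost v k = -1 := by simp [vcost, hvl, Nat.le_zero.1 hle, cost_zero_true]
      have h1 := hq' k fun h _ => h0 ▸ neg_one_le_cost _ _
      have h2 : 0 ≤ vcost w k := by
        simp only [vcost, hwl]; exact cost_false_nonneg _
      rw [hsub k h1, ← h1, h0] at h2
      linarith
    · rfl
  have hge : level w i ≤ level v i := le_of_cost_le (hi ▸ hq i v hv : vcost w i ≤ vcost v i)
  by_cases hone : IsOne w i
  · set m := level w i with hm
    have hmi : m ≤ i.val := level_le_val hone
    obtain ⟨k, hmk, -, -, hle⟩ := exists_next v (hmi.trans (Nat.lt_succ_iff.1 i.isLt))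
    -- Otherwise clearing the one of `w` at `m - 1` stays inside `A` and beats the minimum `q i`.
    have hforced : ∀ h ∈ A, m ≤ level h k := by
      intro h hh
      rcases Nat.eq_zero_or_pos m with h0 | h0
      · omega
      obtain ⟨j, hj, hwj, hjm⟩ := exists_of_level_pos hone h0
      rw [hm, ← hjm]
      refine succ_le_level (by rw [Fin.lt_def]; omega) ?_
      by_contra hhj
      have hhj : h j = false := by simpa using hhj
      have hx := hA.update_mem hw hh j
      rw [hhj] at hx
      have h1 := hq i _ hx
      rw [← hi] at h1
      have h2 := le_of_cost_le h1
      have h3 : level (Function.update w j false) i ≤ m - 1 := by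
        refine level_le_of_isOne ?_ fun j' hj' hwj' => ?_
        · rcases hone with h | h
          · exact Or.inl h
          · exact Or.inr (by rw [Function.update_of_ne hj.ne', h])
        · have hne : j' ≠ j := by rintro rfl; simp at hwj'
          rw [Function.update_of_ne hne] at hwj'
          have h4 := succ_le_level hj' hwj'
          have h5 : j'.val ≠ j.val := fun h => hne (Fin.ext h)
          omega
      omega
    have htie : ∀ h ∈ A, cost m (w (Fin.last n)) ≤ cost m (h (Fin.last n)) := by
      intro h hh
      have h1 := hq i _ (hA.update_mem hw hh (Fin.last n))
      rw [← hi] at h1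
      have h2 : level (Function.update w (Fin.last n) (h (Fin.last n))) i ≤ m := by
        refine level_le_of_isOne ?_ fun j' hj' hwj' => ?_
        · by_cases h : i = Fin.last n
          · exact Or.inl h
          · exact Or.inr (by rw [Function.update_of_ne h]; exact hone.resolve_left h)
        · rw [Function.update_of_ne (ne_last_of_lt hj')] at hwj'
          exact succ_le_level hj' hwj'
      refine h1.trans ?_
      simp only [vcost, Function.update_self]
      exact cost_mono h2 _
    have hvk : level v k = m := le_antisymm hle (hforced v hv)
    have htight := hq' k fun h hh => by
      simp only [vcost, hvk, hlast]
      exact (htie h hh).trans (cost_mono (hforced h hh) _)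
    have hwk : level w k = m := by
      have h1 := (hsub k htight).trans htight.symm
      simp only [vcost, hvk, hlast] at h1
      exact le_antisymm (le_of_cost_le h1.le) (le_of_cost_le h1.ge)
    have hwk1 : IsOne w k := isOne_of_level_le (by omega)
    -- Both are ones of `w` at level `m` and position at least `m`; the earlier would push the level
    -- of the later above `m`.
    have hki : k = i := by
      rcases lt_trichotomy k i with h | h | h
      · have := succ_le_level h (eq_true_of_isOne hwk1 h)
        omega
      · exact h
      · have := succ_le_level h (eq_true_of_isOne hone h)
        omega
    exact hki ▸ htight
  · have h1 := level_le_succ v i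
    rw [level_of_not_isOne hone] at hge
    rw [← hi]
    simp only [vcost, hlast, level_of_not_isOne hone, le_antisymm h1 hge]

/-- The vertex set of a face, other than those that contain the removed facet, is the set of
vertices above critical thresholds. -/
theorem exists_isCritical {A : Set (Fin (n + 1) → Bool)} (hA : IsVertexClosed A)
    (hne : A.Nonempty) (htop : ¬ topVertices n ⊆ A) :
    ∃ q : Fin (n + 1) → ℝ, IsCritical q ∧ {x | q ≤ vcost x} = A := by
  have hmin : ∀ i, ∃ h ∈ A, ∀ h' ∈ A, vcost h i ≤ vcost h' i := fun i =>
    Set.exists_min_image A (fun h => vcost h i) A.toFinite hne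
  choose w hwA hw using hmin
  let q : Fin (n + 1) → ℝ := fun i => vcost (w i) i
  have hS : ∀ x, q ≤ vcost x ↔ x ∈ A := by
    refine fun x => ⟨fun hx => ?_, fun hx i => hw i x hx⟩
    by_contra hxA
    obtain ⟨i, hi⟩ := exists_vcost_lt hA hne htop hxA
    exact absurd (hx i) (not_le.2 (hi _ (hwA i)))
  refine ⟨q, fun i => ⟨w i, (hS _).2 (hwA i), rfl, fun v hv hsub => ?_⟩, Set.ext hS⟩
  exact tight_of_tight_subset hA htop (fun i h hh => hw i h hh) (fun i => ⟨w i, hwA i, rfl⟩)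
    (hwA i) ((hS v).1 hv) hsub rfl

/-- A single vertex is a face, so `exists_vcost_lt` separates it from any other vertex. For `n = 0`
the vertex 1 is itself the removed facet, and the two generators are comparable. -/
theorem isAntichain_range_neg_vcost (hn : 0 < n) :
    IsAntichain (· ≤ ·) (Set.range fun x : Fin (n + 1) → Bool => -vcost x) := by
  classical
  rintro _ ⟨v, rfl⟩ _ ⟨w, rfl⟩ hne hle
  have hvw : v ∉ ({w} : Set (Fin (n + 1) → Bool)) := by
    rintro rfl; exact hne rfl
  have hclosed : IsVertexClosed ({w} : Set (Fin (n + 1) → Bool)) := fun x hx => by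
    funext j
    obtain ⟨v, rfl, h⟩ := hx j
    exact h.symm
  obtain ⟨i, hi⟩ := exists_vcost_lt hclosed ⟨w, rfl⟩ (fun hsub => by
    have h1 := hsub (show (fun _ => true) ∈ topVertices n from rfl)
    have h2 := hsub (show (fun j => decide (j = Fin.last n)) ∈ topVertices n by simp [topVertices])
    have h3 := congrFun (h1.trans h2.symm) 0
    have h4 : (0 : Fin (n + 1)) ≠ Fin.last n := by
      intro h; have := congrArg Fin.val h; simp at this; omega
    simp [h4] at h3) hvw
  have h1 := hle i
  have h2 := hi w rfl
  simp only [Pi.neg_apply] at h1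
  linarith

theorem isCharacteristicPoint_range_neg_vcost (p : Fin (n + 1) → ℝ) :
    IsCharacteristicPoint (Set.range fun x : Fin (n + 1) → Bool => -vcost x) p ↔
      IsCritical (-p) := by
  rw [isCharacteristicPoint_iff (Set.finite_range _)]
  have hle : ∀ v : Fin (n + 1) → Bool, -vcost v ≤ p ↔ -p ≤ vcost v := fun v => neg_le
  have heq : ∀ (v : Fin (n + 1) → Bool) i, (-vcost v) i = p i ↔ vcost v i = (-p) i :=
    fun v i => by simp only [Pi.neg_apply]; exact neg_eq_iff_eq_neg
  simp only [Set.exists_range_iff, Set.forall_mem_range, hle, heq, IsCritical]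

end Levels

/-! ### Faces of the cube and their vertex sets. -/

section CubeFaces

variable {d : ℕ}

/-- The vertex of the cube with the given coordinates. -/
def vertexPoint (x : Fin d → Bool) : Fin d → ℝ := fun j => if x j = true then 1 else 0

/-- The vertices of the cube that lie in `G`. -/
def vertexSet (G : Set (Fin d → ℝ)) : Set (Fin d → Bool) := {x | vertexPoint x ∈ G}

/-- The smallest face of the cube with the vertices in `A`. -/
def cubeHull (A : Set (Fin d → Bool)) : Set (Fin d → ℝ) :=
  {y | y ∈ cube d ∧ ∀ j, (y j < 1 → ∃ v ∈ A, v j = false) ∧ (0 < y j → ∃ v ∈ A, v j = true)}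

theorem mem_cube {y : Fin d → ℝ} : y ∈ cube d ↔ ∀ j, 0 ≤ y j ∧ y j ≤ 1 :=
  ⟨fun h j => ⟨h.1 j, h.2 j⟩, fun h => ⟨fun j => (h j).1, fun j => (h j).2⟩⟩

theorem vertexPoint_mem_cube (x : Fin d → Bool) : vertexPoint x ∈ cube d :=
  mem_cube.2 fun j => by by_cases h : x j = true <;> simp [vertexPoint, h]

theorem update_mem_cube {y : Fin d → ℝ} (hy : y ∈ cube d) (j : Fin d) {t : ℝ} (h0 : 0 ≤ t)
    (h1 : t ≤ 1) : Function.update y j t ∈ cube d :=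
  mem_cube.2 fun k => by
    by_cases h : k = j
    · subst h; simp [h0, h1]
    · simpa [h] using mem_cube.1 hy k

theorem setOf_maximizes_cube (c : Fin d → ℝ) :
    {y | y ∈ cube d ∧ ∀ z ∈ cube d, ∑ j, c j * z j ≤ ∑ j, c j * y j} =
      {y | y ∈ cube d ∧ ∀ j, (0 < c j → y j = 1) ∧ (c j < 0 → y j = 0)} := by
  ext y
  refine and_congr_right fun hy => ⟨fun h j => ?_, fun h z hz => ?_⟩
  · have hupd : ∀ t : ℝ, 0 ≤ t → t ≤ 1 → c j * t ≤ c j * y j := by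
      intro t h0 h1
      have := h _ (update_mem_cube hy j h0 h1)
      rw [← Finset.add_sum_erase _ _ (Finset.mem_univ j),
        ← Finset.add_sum_erase _ (fun k => c k * y k) (Finset.mem_univ j)] at this
      have heq : ∑ k ∈ Finset.univ.erase j, c k * Function.update y j t k =
          ∑ k ∈ Finset.univ.erase j, c k * y k :=
        Finset.sum_congr rfl fun k hk => by rw [Function.update_of_ne (Finset.ne_of_mem_erase hk)]
      rw [heq, Function.update_self] at this
      linarith
    have hj := mem_cube.1 hy j
    refine ⟨fun hc => le_antisymm hj.2 ?_, fun hc => le_antisymm ?_ hj.1⟩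
    · exact le_of_mul_le_mul_left (hupd 1 zero_le_one le_rfl) hc
    · exact (mul_le_mul_left_of_neg hc).1 (hupd 0 le_rfl zero_le_one)
  · refine Finset.sum_le_sum fun j _ => ?_
    have hj := mem_cube.1 hz j
    rcases lt_trichotomy (c j) 0 with hc | hc | hc
    · rw [(h j).2 hc]; nlinarith
    · simp [hc]
    · rw [(h j).1 hc]; nlinarith

theorem isFace_cube_iff {G : Set (Fin d → ℝ)} :
    IsFace (cube d) G ↔ G.Nonempty → ∃ c : Fin d → ℝ,
      G = {y | y ∈ cube d ∧ ∀ j, (0 < c j → y j = 1) ∧ (c j < 0 → y j = 0)} := by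
  classical
  constructor
  · intro h hne
    obtain ⟨l, hl⟩ := h hne
    refine ⟨fun j => l (Pi.single j 1), ?_⟩
    have hsum : ∀ y : Fin d → ℝ, l y = ∑ j, l (Pi.single j 1) * y j := by
      intro y
      conv_lhs => rw [← Finset.univ_sum_single y]
      rw [map_sum]
      refine Finset.sum_congr rfl fun j _ => ?_
      have : (Pi.single j (y j) : Fin d → ℝ) = y j • Pi.single j 1 := by
        rw [← Pi.single_smul]; simp
      rw [this, map_smul, smul_eq_mul, mul_comm]
    rw [hl, ← setOf_maximizes_cube]
    ext y
    refine and_congr_right fun _ => forall₂_congr fun z _ => ?_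
    rw [hsum z, hsum y]
  · intro h hne
    obtain ⟨c, hc⟩ := h hne
    refine ⟨∑ j, c j • ContinuousLinearMap.proj j, ?_⟩
    rw [hc, ← setOf_maximizes_cube]
    simp

theorem isFace_cubeHull (A : Set (Fin d → Bool)) : IsFace (cube d) (cubeHull A) := by
  classical
  -- The functional has coefficient 1 where `A` is constantly one, -1 where it is constantly zero,
  -- and 0 where both values occur.
  refine isFace_cube_iff.2 fun hne => ⟨fun j =>
    (if ∀ v ∈ A, v j = true then 1 else 0) - (if ∀ v ∈ A, v j = false then 1 else 0), ?_⟩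
  obtain ⟨y₀, -, hy₀⟩ := hne
  ext y
  refine and_congr_right fun hy => forall_congr' fun j => ?_
  have hj := mem_cube.1 hy j
  have hAne : A.Nonempty := by
    rcases lt_or_ge (y₀ j) 1 with h | h
    · obtain ⟨v, hv, -⟩ := (hy₀ j).1 h; exact ⟨v, hv⟩
    · obtain ⟨v, hv, -⟩ := (hy₀ j).2 (by linarith); exact ⟨v, hv⟩
  obtain ⟨v₀, hv₀⟩ := hAne
  have hnt : (¬ ∀ v ∈ A, v j = true) ↔ ∃ v ∈ A, v j = false := by push Not; simp
  have hnf : (¬ ∀ v ∈ A, v j = false) ↔ ∃ v ∈ A, v j = true := by push Not; simp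
  by_cases ht : ∀ v ∈ A, v j = true
  · have hf : ¬ ∀ v ∈ A, v j = false := fun hf => by simpa [ht v₀ hv₀] using hf v₀ hv₀
    have ht' : ¬ ∃ v ∈ A, v j = false := fun h => hnt.2 h ht
    simp only [if_pos ht, if_neg hf, ht', hnf.1 hf]
    constructor
    · rintro ⟨h, -⟩
      refine ⟨fun _ => le_antisymm hj.2 (not_lt.1 h), fun h' => ?_⟩
      norm_num at h'
    · rintro ⟨h, -⟩
      exact ⟨fun h' => absurd (h (by norm_num)) h'.ne, fun _ => trivial⟩
  · by_cases hf : ∀ v ∈ A, v j = false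
    · have hf' : ¬ ∃ v ∈ A, v j = true := fun h => hnf.2 h hf
      simp only [if_neg ht, if_pos hf, hf', hnt.1 ht]
      constructor
      · rintro ⟨-, h⟩
        refine ⟨fun h' => ?_, fun _ => le_antisymm (not_lt.1 h) hj.1⟩
        norm_num at h'
      · rintro ⟨-, h⟩
        exact ⟨fun _ => trivial, fun h' => absurd (h (by norm_num)) h'.ne'⟩
    · simp [ht, hf, hnt.1 ht, hnf.1 hf]

/-- A face is given by a sign vector, and its vertices take both values in every free coordinate. In
dimension 0 the hull of the empty set would be a point, so a coordinate is required. -/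
theorem IsFace.eq_cubeHull [Nonempty (Fin d)] {G : Set (Fin d → ℝ)} (hG : IsFace (cube d) G) :
    G = cubeHull (vertexSet G) := by
  classical
  rcases G.eq_empty_or_nonempty with rfl | hne
  · symm
    rw [eq_empty_iff_forall_notMem]
    rintro y ⟨-, hy⟩
    have j : Fin d := Classical.arbitrary _
    rcases lt_or_ge (y j) 1 with h | h
    · obtain ⟨v, hv, -⟩ := (hy j).1 h; exact hv
    · obtain ⟨v, hv, -⟩ := (hy j).2 (by linarith); exact hv
  · obtain ⟨c, rfl⟩ := isFace_cube_iff.1 hG hne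
    have hmem : ∀ (j : Fin d) (b : Bool), (0 < c j → b = true) → (c j < 0 → b = false) →
        ∃ v ∈ vertexSet {y | y ∈ cube d ∧ ∀ j, (0 < c j → y j = 1) ∧ (c j < 0 → y j = 0)},
          v j = b := by
      intro j b h1 h2
      refine ⟨Function.update (fun k => decide (0 < c k)) j b, ⟨vertexPoint_mem_cube _, ?_⟩,
        by simp⟩
      intro k
      by_cases hk : k = j
      · subst hk
        simp only [vertexPoint, Function.update_self]
        exact ⟨fun h => by simp [h1 h], fun h => by simp [h2 h]⟩
      · simp only [vertexPoint, Function.update_of_ne hk]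
        exact ⟨fun h => by simp [h], fun h => by simp [h.le]⟩
    ext y
    refine and_congr_right fun hy => forall_congr' fun j => ?_
    have hj := mem_cube.1 hy j
    constructor
    · rintro ⟨h1, h2⟩
      refine ⟨fun h => hmem j false (fun hc => ?_) fun _ => rfl,
        fun h => hmem j true (fun _ => rfl) fun hc => ?_⟩
      · exact absurd (h1 hc) h.ne
      · exact absurd (h2 hc) h.ne'
    · rintro ⟨h1, h2⟩
      refine ⟨fun hc => le_antisymm hj.2 (not_lt.1 fun h => ?_),
        fun hc => le_antisymm (not_lt.1 fun h => ?_) hj.1⟩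
      · obtain ⟨v, ⟨-, hv⟩, hvj⟩ := h1 h
        simpa [vertexPoint, hvj] using (hv j).1 hc
      · obtain ⟨v, ⟨-, hv⟩, hvj⟩ := h2 h
        simpa [vertexPoint, hvj] using (hv j).2 hc

theorem mem_vertexSet_cubeHull {A : Set (Fin d → Bool)} {x : Fin d → Bool} :
    x ∈ vertexSet (cubeHull A) ↔ ∀ j, ∃ v ∈ A, v j = x j := by
  simp only [vertexSet, cubeHull, mem_ofPred_eq, vertexPoint_mem_cube, true_and]
  refine forall_congr' fun j => ?_
  cases h : x j <;> simp [vertexPoint, h]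

theorem IsVertexClosed.vertexSet_cubeHull {A : Set (Fin d → Bool)} (hA : IsVertexClosed A) :
    vertexSet (cubeHull A) = A := by
  ext x
  rw [mem_vertexSet_cubeHull]
  exact ⟨hA x, fun hx j => ⟨x, hx, rfl⟩⟩

theorem IsFace.isVertexClosed_vertexSet [Nonempty (Fin d)] {G : Set (Fin d → ℝ)}
    (hG : IsFace (cube d) G) : IsVertexClosed (vertexSet G) := by
  intro x hx
  rw [hG.eq_cubeHull]
  exact mem_vertexSet_cubeHull.2 hx

theorem vertexSet_mono {G H : Set (Fin d → ℝ)} (h : G ⊆ H) : vertexSet G ⊆ vertexSet H :=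
  fun _ hx => h hx

theorem cubeHull_mono {A B : Set (Fin d → Bool)} (h : A ⊆ B) : cubeHull A ⊆ cubeHull B := by
  rintro y ⟨hy, hyA⟩
  exact ⟨hy, fun j => ⟨fun hj => let ⟨v, hv, e⟩ := (hyA j).1 hj; ⟨v, h hv, e⟩,
    fun hj => let ⟨v, hv, e⟩ := (hyA j).2 hj; ⟨v, h hv, e⟩⟩⟩

theorem isVertexClosed_univ : IsVertexClosed (univ : Set (Fin d → Bool)) :=
  fun _ _ => mem_univ _

theorem isVertexClosed_empty [Nonempty (Fin d)] : IsVertexClosed (∅ : Set (Fin d → Bool)) :=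
  fun _ hx => let ⟨_, hv, _⟩ := hx (Classical.arbitrary _); hv

end CubeFaces

/-! ### The removed facet and the lattice isomorphism. -/

section Facet

variable {n : ℕ}

theorem isVertexClosed_topVertices (n : ℕ) : IsVertexClosed (topVertices n) := fun _ hx =>
  let ⟨_, hv, h⟩ := hx (Fin.last n)
  h.symm.trans hv

theorem IsVertexClosed.eq_univ_of_topVertices_subset {A : Set (Fin (n + 1) → Bool)}
    (hA : IsVertexClosed A) (htop : topVertices n ⊆ A) (hne : A ≠ topVertices n) : A = univ := by
  obtain ⟨x, hxA, hx⟩ := Set.not_subset.1 fun h => hne (h.antisymm htop)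
  have hx : x (Fin.last n) = false := by simpa [topVertices] using hx
  refine eq_univ_of_forall fun y => hA y fun j => ?_
  by_cases hj : j = Fin.last n
  · subst hj
    cases hy : y (Fin.last n)
    · exact ⟨x, hxA, hx⟩
    · exact ⟨y, htop hy, hy⟩
  · exact ⟨Function.update y (Fin.last n) true, htop (by simp [topVertices]), by simp [hj]⟩

theorem cubeHull_topVertices :
    cubeHull (topVertices n) = {y | y ∈ cube (n + 1) ∧ y (Fin.last n) = 1} := by
  ext y
  refine and_congr_right fun hy => ⟨fun h => ?_, fun h j => ?_⟩
  · refine le_antisymm (mem_cube.1 hy _).2 (not_lt.1 fun hlt => ?_)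
    obtain ⟨v, hv, hv'⟩ := (h (Fin.last n)).1 hlt
    exact absurd (hv'.symm.trans hv) (by simp)
  · refine ⟨fun hj => ⟨fun k => decide (k = Fin.last n), by simp [topVertices], ?_⟩,
      fun _ => ⟨fun _ => true, rfl, rfl⟩⟩
    have : j ≠ Fin.last n := by rintro rfl; exact hj.ne h
    simpa using this

theorem vectorSpan_cube (d : ℕ) : vectorSpan ℝ (cube d) = ⊤ := by
  classical
  have h0 : (0 : Fin d → ℝ) ∈ cube d := mem_cube.2 fun _ => by simp
  have hs : ∀ j, (Pi.single j 1 : Fin d → ℝ) ∈ vectorSpan ℝ (cube d) := fun j => by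
    have h1 : (Pi.single j 1 : Fin d → ℝ) ∈ cube d := update_mem_cube h0 j zero_le_one le_rfl
    simpa using vsub_mem_vectorSpan ℝ h1 h0
  refine eq_top_iff.2 fun y _ => ?_
  rw [pi_eq_sum_univ' y]
  refine Submodule.sum_mem _ fun j _ => Submodule.smul_mem _ _ ?_
  exact hs j

theorem vectorSpan_cubeHull_topVertices :
    vectorSpan ℝ (cubeHull (topVertices n)) =
      LinearMap.ker (LinearMap.proj (Fin.last n) : (Fin (n + 1) → ℝ) →ₗ[ℝ] ℝ) := by
  classical
  rw [cubeHull_topVertices]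
  apply le_antisymm
  · rw [vectorSpan_def, Submodule.span_le]
    rintro _ ⟨x, hx, y, hy, rfl⟩
    simp [hx.2, hy.2]
  · have h0 : (1 : Fin (n + 1) → ℝ) ∈ cube (n + 1) := mem_cube.2 fun _ => by simp
    have hs : ∀ j, j ≠ Fin.last n → (Pi.single j 1 : Fin (n + 1) → ℝ) ∈
        vectorSpan ℝ {y | y ∈ cube (n + 1) ∧ y (Fin.last n) = 1} := fun j hj => by
      have h1 := update_mem_cube h0 j le_rfl zero_le_one
      have h2 := vsub_mem_vectorSpan ℝ
        (s := {y | y ∈ cube (n + 1) ∧ y (Fin.last n) = 1}) ⟨h0, rfl⟩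
        ⟨h1, by simp [hj.symm]⟩
      convert h2 using 1
      ext k
      by_cases hk : k = j
      · subst hk; simp
      · simp [hk]
    intro y hy
    have hy : y (Fin.last n) = 0 := hy
    rw [pi_eq_sum_univ' y]
    refine Submodule.sum_mem _ fun j _ => ?_
    by_cases hj : j = Fin.last n
    · rw [hj, hy, zero_smul]; exact Submodule.zero_mem _
    · refine Submodule.smul_mem _ _ ?_
      exact hs j hj

theorem isFacet_cubeHull_topVertices :
    IsFacet (cube (n + 1)) (cubeHull (topVertices n)) := by
  refine ⟨isFace_cubeHull _, ?_, ?_⟩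
  · rw [cubeHull_topVertices]
    exact ⟨1, mem_cube.2 fun _ => by simp, rfl⟩
  · rw [vectorSpan_cube, vectorSpan_cubeHull_topVertices, finrank_top]
    have h := LinearMap.finrank_range_add_finrank_ker
      (LinearMap.proj (Fin.last n) : (Fin (n + 1) → ℝ) →ₗ[ℝ] ℝ)
    rw [LinearMap.range_eq_top.2 (LinearMap.proj_surjective _), finrank_top,
      Module.finrank_self] at h
    omega

/-- The face lattice of the cube without one facet is a lattice. -/
theorem isLatticeOrder_faceLatticeWithout :
    IsLatticeOrder (FaceLatticeWithout (cube (n + 1)) (cubeHull (topVertices n))) := by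
  rintro ⟨G, hG, hGF⟩ ⟨H, hH, hHF⟩
  have hclosed := isVertexClosed_topVertices n
  have hsup : ∀ K : Set (Fin (n + 1) → ℝ), IsFace (cube (n + 1)) K →
      K ≠ cubeHull (topVertices n) → cubeHull (topVertices n) ⊆ K → K = cubeHull univ := by
    intro K hK hKF hFK
    rw [hK.eq_cubeHull, hK.isVertexClosed_vertexSet.eq_univ_of_topVertices_subset]
    · exact hclosed.vertexSet_cubeHull ▸ vertexSet_mono hFK
    · exact fun h => hKF (h ▸ hK.eq_cubeHull)
  constructor
  · have hle : ∀ K : Set (Fin (n + 1) → ℝ), IsFace (cube (n + 1)) K → G ⊆ K → H ⊆ K →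
        cubeHull (vertexSet G ∪ vertexSet H) ⊆ K := fun K hK hGK hHK => by
      rw [hK.eq_cubeHull]
      exact cubeHull_mono (union_subset (vertexSet_mono hGK) (vertexSet_mono hHK))
    have hGle : G ⊆ cubeHull (vertexSet G ∪ vertexSet H) :=
      hG.eq_cubeHull.subset.trans (cubeHull_mono subset_union_left)
    have hHle : H ⊆ cubeHull (vertexSet G ∪ vertexSet H) :=
      hH.eq_cubeHull.subset.trans (cubeHull_mono subset_union_right)
    -- If the join is the removed facet, the whole cube replaces it, being the only other face that
    -- contains the facet.
    by_cases h : cubeHull (vertexSet G ∪ vertexSet H) = cubeHull (topVertices n)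
    · refine ⟨⟨cubeHull univ, isFace_cubeHull _, fun h' => ?_⟩, ?_, ?_⟩
      · have h1 := congrArg vertexSet h'
        rw [isVertexClosed_univ.vertexSet_cubeHull, hclosed.vertexSet_cubeHull] at h1
        have h2 : (fun _ => false) ∈ topVertices n := h1 ▸ mem_univ _
        exact absurd h2 (by simp [topVertices])
      · rintro _ (rfl | rfl)
        · exact hGle.trans (cubeHull_mono (subset_univ _))
        · exact hHle.trans (cubeHull_mono (subset_univ _))
      · rintro ⟨K, hK, hKF⟩ hub
        exact (hsup K hK hKF (h ▸ hle K hK (hub (mem_insert _ _))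
          (hub (mem_insert_of_mem _ rfl)))).ge
    · refine ⟨⟨_, isFace_cubeHull _, h⟩, ?_, ?_⟩
      · rintro _ (rfl | rfl)
        · exact hGle
        · exact hHle
      · rintro ⟨K, hK, hKF⟩ hub
        exact hle K hK (hub (mem_insert _ _)) (hub (mem_insert_of_mem _ rfl))
  -- If the meet were the removed facet, `G` and `H` would both be the whole cube, and so would
  -- their meet.
  · refine ⟨⟨G ∩ H, IsExposed.inter hG hH, fun h => ?_⟩, ?_, ?_⟩
    · have h1 := hsup G hG hGF (h ▸ inter_subset_left)
      have h2 := hsup H hH hHF (h ▸ inter_subset_right)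
      rw [h2, ← h1, inter_self] at h
      exact hGF h
    · rintro _ (rfl | rfl)
      · exact inter_subset_left
      · exact inter_subset_right
    · rintro ⟨K, hK, hKF⟩ hlb
      exact subset_inter (hlb (mem_insert _ _)) (hlb (mem_insert_of_mem _ rfl))

theorem IsLatticeOrder.of_orderIso {α β : Type*} [PartialOrder α] [PartialOrder β] (e : α ≃o β)
    (h : IsLatticeOrder α) : IsLatticeOrder β := by
  intro a b
  have himage : e '' {e.symm a, e.symm b} = {a, b} := by simp [image_pair]
  obtain ⟨⟨c, hc⟩, c', hc'⟩ := h (e.symm a) (e.symm b)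
  exact ⟨⟨e c, himage ▸ e.isLUB_image'.2 hc⟩, e c', himage ▸ e.isGLB_image'.2 hc'⟩

/-- The vertex sets of the faces of the cube other than the removed facet, ordered by inclusion,
realize the cp-order as soon as those of the faces not containing the removed facet realize the
characteristic points. -/
theorem isRealizable_cube_of_vertexSets {V : Set (Fin (n + 1) → ℝ)} (hfin : V.Finite)
    (hanti : IsAntichain (· ≤ ·) V) (S : (Fin (n + 1) → ℝ) → Set (Fin (n + 1) → Bool))
    (hclosed : ∀ p, IsCharacteristicPoint V p → IsVertexClosed (S p))
    (hne : ∀ p, IsCharacteristicPoint V p → (S p).Nonempty)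
    (htop : ∀ p, IsCharacteristicPoint V p → ¬ topVertices n ⊆ S p)
    (hsurj : ∀ A, IsVertexClosed A → A.Nonempty → ¬ topVertices n ⊆ A →
      ∃ p, IsCharacteristicPoint V p ∧ S p = A)
    (hle : ∀ p p', IsCharacteristicPoint V p → IsCharacteristicPoint V p' →
      (S p ⊆ S p' ↔ p ≤ p')) :
    IsRealizable (cube (n + 1)) := by
  let verts : CPOrder V → Set (Fin (n + 1) → Bool) :=
    WithBot.recBotCoe ∅ (WithTop.recTopCoe univ fun p => S p.1)
  have hcl : ∀ q, IsVertexClosed (verts q) := by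
    intro q
    induction q using WithBot.recBotCoe with
    | bot => exact isVertexClosed_empty
    | coe q =>
      induction q using WithTop.recTopCoe with
      | top => exact isVertexClosed_univ
      | coe p => exact hclosed p.1 p.2
  have hneF : ∀ q, verts q ≠ topVertices n := by
    intro q
    induction q using WithBot.recBotCoe with
    | bot =>
      intro h
      have : (fun _ => true) ∈ verts ⊥ := h ▸ (rfl : (fun _ => true) ∈ topVertices n)
      exact this
    | coe q =>
      induction q using WithTop.recTopCoe with
      | top =>
        intro h
        have : (fun _ => false) ∈ topVertices n := h ▸ mem_univ _
        exact absurd this (by simp [topVertices])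
      | coe p => exact fun h => htop p.1 p.2 h.ge
  have hmono : ∀ q q', verts q ⊆ verts q' ↔ q ≤ q' := by
    intro q q'
    induction q using WithBot.recBotCoe with
    | bot => exact iff_of_true (empty_subset _) bot_le
    | coe q =>
      induction q' using WithBot.recBotCoe with
      | bot =>
        refine iff_of_false (fun h => ?_) (WithBot.not_coe_le_bot q)
        induction q using WithTop.recTopCoe with
        | top => exact h (mem_univ fun _ => true)
        | coe p => exact (hne p.1 p.2).ne_empty (subset_empty_iff.1 h)
      | coe q' =>
        rw [WithBot.coe_le_coe]
        induction q' using WithTop.recTopCoe with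
        | top => exact iff_of_true (subset_univ _) le_top
        | coe p' =>
          induction q using WithTop.recTopCoe with
          | top =>
            exact iff_of_false (fun h => htop p'.1 p'.2 ((subset_univ _).trans h))
              (WithTop.not_top_le_coe p')
          | coe p =>
            rw [WithTop.coe_le_coe]
            exact hle p.1 p'.1 p.2 p'.2
  let f : CPOrder V → FaceLatticeWithout (cube (n + 1)) (cubeHull (topVertices n)) := fun q =>
    ⟨cubeHull (verts q), isFace_cubeHull _, fun h => hneF q (by
      rw [← (hcl q).vertexSet_cubeHull, h, (isVertexClosed_topVertices n).vertexSet_cubeHull])⟩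
  have hf : ∀ q q', f q ≤ f q' ↔ q ≤ q' := by
    intro q q'
    rw [← hmono]
    refine ⟨fun h => ?_, fun h => cubeHull_mono h⟩
    rw [← (hcl q).vertexSet_cubeHull, ← (hcl q').vertexSet_cubeHull]
    exact vertexSet_mono h
  have hfsurj : Function.Surjective f := by
    rintro ⟨G, hG, hGF⟩
    suffices ∃ q, verts q = vertexSet G by
      obtain ⟨q, hq⟩ := this
      exact ⟨q, Subtype.ext (by simp only [f]; rw [hq, ← hG.eq_cubeHull])⟩
    have hGcl := hG.isVertexClosed_vertexSet
    rcases (vertexSet G).eq_empty_or_nonempty with h | h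
    · exact ⟨⊥, h.symm⟩
    by_cases ht : topVertices n ⊆ vertexSet G
    · refine ⟨WithBot.some ⊤, (hGcl.eq_univ_of_topVertices_subset ht ?_).symm⟩
      exact fun h' => hGF (h' ▸ hG.eq_cubeHull)
    · obtain ⟨p, hp, hS⟩ := hsurj _ hGcl h ht
      exact ⟨WithBot.some (WithTop.some ⟨p, hp⟩), hS⟩
  let e : CPOrder V ≃o FaceLatticeWithout (cube (n + 1)) (cubeHull (topVertices n)) :=
    RelIso.ofSurjective (OrderEmbedding.ofMapLEIff f hf) hfsurj
  exact ⟨_, isFacet_cubeHull_topVertices, V, hfin, hanti,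
    isLatticeOrder_faceLatticeWithout.of_orderIso e.symm, ⟨e.symm⟩⟩

theorem isRealizable_cube_of_pos (hn : 0 < n) : IsRealizable (cube (n + 1)) := by
  have hcp := isCharacteristicPoint_range_neg_vcost (n := n)
  refine isRealizable_cube_of_vertexSets (Set.finite_range _) (isAntichain_range_neg_vcost hn)
    (fun p => {x | -p ≤ vcost x}) (fun p hp => ((hcp p).1 hp).isVertexClosed)
    (fun p hp => ((hcp p).1 hp).nonempty) (fun p hp => ((hcp p).1 hp).not_topVertices_subset)
    (fun A hA hne htop => ?_) (fun p p' hp hp' => ⟨fun h i => ?_, fun h x hx => ?_⟩)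
  · obtain ⟨q, hq, hS⟩ := exists_isCritical hA hne htop
    exact ⟨-q, (hcp _).2 (by rwa [neg_neg]), by simpa only [neg_neg] using hS⟩
  -- Dominance is recovered from inclusion because each threshold of `p` is attained by a vertex in
  -- its set.
  · obtain ⟨w, hw, hi, -⟩ := (hcp p).1 hp i
    have h1 := h hw i
    rw [hi] at h1
    exact neg_le_neg_iff.1 h1
  · exact (neg_le_neg h).trans hx

/-- A segment without one endpoint has a chain of three faces, which a single generator realizes. -/
theorem isRealizable_cube_one : IsRealizable (cube 1) := by
  have hcp : ∀ p : Fin 1 → ℝ, IsCharacteristicPoint {0} p ↔ p = 0 := by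
    intro p
    rw [isCharacteristicPoint_iff (Set.finite_singleton _)]
    constructor
    · intro h
      funext i
      obtain ⟨w, hw, -, hi, -⟩ := h i
      rw [mem_singleton_iff] at hw
      rw [← hi, hw]
    · rintro rfl i
      exact ⟨0, rfl, le_rfl, rfl, fun v hv _ _ => by rw [mem_singleton_iff.1 hv]⟩
  refine isRealizable_cube_of_vertexSets (n := 0) (Set.finite_singleton 0)
    (Set.subsingleton_singleton.isAntichain _) (fun _ => {fun _ => false})
    (fun p _ x hx => ?_) (fun p _ => Set.singleton_nonempty _) (fun p _ h => ?_)
    (fun A hA hne htop => ⟨0, (hcp 0).2 rfl, ?_⟩) (fun p p' hp hp' => ?_)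
  · funext j
    obtain ⟨v, hv, hvj⟩ := hx j
    rw [← hvj, mem_singleton_iff.1 hv]
  · have := congrFun (h (show (fun _ => true) ∈ topVertices 0 from rfl)) 0
    simp at this
  · have huniq : ∀ x y : Fin 1 → Bool, x 0 = y 0 → x = y := fun x y h => by
      funext j; rwa [Subsingleton.elim j 0]
    have hfalse : ∀ x ∈ A, x 0 = false := fun x hx => by
      by_contra hx0
      refine htop fun y hy => ?_
      rwa [huniq y x (hy.trans (by simpa using hx0 : x 0 = true).symm)]
    obtain ⟨x, hx⟩ := hne
    ext y
    rw [mem_singleton_iff]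
    exact ⟨fun hy => by rwa [hy, huniq (fun _ => false) x (hfalse x hx).symm],
      fun hy => huniq _ _ (hfalse y hy)⟩
  · rw [(hcp p).1 hp, (hcp p').1 hp']
    simp

end Facet

end OrthogonalSurface

theorem mainTheorem9 (d : ℕ) (hd : 1 ≤ d) :
    OrthogonalSurface.IsRealizable (OrthogonalSurface.cube d) := by
  obtain ⟨n, rfl⟩ : ∃ n, d = n + 1 := ⟨d - 1, by omega⟩
  rcases Nat.eq_zero_or_pos n with rfl | hn
  · exact OrthogonalSurface.isRealizable_cube_one
  · exact OrthogonalSurface.isRealizable_cube_of_pos hn
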